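/- Let $\mathbb T=\mathbb R/\mathbb Z$ and, for $z\in\mathbb T$, let $|z \ (\mathrm{mod}\ 1)|$ be the absolute value of the representative of $z$ in $[-1/2,1/2)$. A torus polynomial of degree at most $d$ is a function $P:\{0,1\}^n\to\mathbb T$ of the form $P(x)=\sum_{S\subseteq[n],\,|S|\le d}P_S\prod_{i\in S}x_i \pmod 1$ with coefficients $P_S\in\mathbb R$. For $f:\{0,1\}^n\to\{0,1\}$ and $\varepsilon>0$, the toroidal $\varepsilon$-approximation degree $\overline{\deg}_\varepsilon(f)$ is the least $d\ge 0$ for which there is a torus polynomial $P$ of degree at most $d$ with $\max_{x\in\{0,1\}^n}\left|P(x)-\tfrac{f(x)}2 \ (\mathrm{mod}\ 1)\right|\le\varepsilon$. Let $p$ be a prime. $\mathrm{AC}^0[p]$ is the class of families $(f_n:\{0,1\}^n\to\{0,1\})_{n\ge 0}$ computed by circuits of constant depth and polynomial size (number of gates) with AND, OR and $\mathrm{MOD}_p$ gates of unbounded fan-in and NOT gates, where a $\mathrm{MOD}_p$ gate outputs $1$ if and only if the sum of its inputs is nonzero modulo $p$. Write $\log^+ t=\max(0,\log t)$ for $t>0$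 and $\log^+0=0$. **Corollary.** For every family $(f_n)\in\mathrm{AC}^0[p]$ there are constants $C\in\mathbb R$ and $c\in\mathbb N$ such that, for all $n$ and all $\varepsilon>0$, $$\overline{\deg}_\varepsilon(f_n)\le C\,\bigl(\log^+(n/\varepsilon)\bigr)^c ,$$ that is, $\overline{\deg}_\varepsilon(f_n)\le\mathrm{polylog}(n/\varepsilon)$. Moreover, the constants depend only on $p$, on the depth and on the size bound: for every $d\in\mathbb N$ and every polynomial $q$ with coefficients in $\mathbb N$ there are constants $C,c$ such that the bound $\overline{\deg}_\varepsilon(f)\le C(\log^+(n/\varepsilon))^c$ holds for all $n$, all $f:\{0,1\}^n\to\{0,1\}$ computed by a circuit of the above kind of depth at most $d$ and size at most $q(n)$, and all $\varepsilon>0$. -/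

import Mathlib

namespace TorusApprox

/-! ## Torus polynomials and the toroidal approximation degree -/

/-- A Boolean function on `n` variables. -/
abbrev BoolFun (n : ℕ) : Type := (Fin n → Bool) → Bool

/-- A function from the Boolean cube to the torus `ℝ / ℤ`.  Its norm is the maximum over the cube of
the norm `|z (mod 1)|` on `ℝ / ℤ` (see `norm_torus_coe` and `norm_le_iff`). -/
abbrev TorusFun (n : ℕ) : Type := (Fin n → Bool) → UnitAddCircle

/-- `P` is a torus polynomial of degree at most `d`:
`P(x) = ∑_{|S| ≤ d} P_S ∏_{i ∈ S} x_i (mod 1)` with real coefficients `P_S`. -/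
def IsTorusPoly {n : ℕ} (d : ℕ) (P : TorusFun n) : Prop :=
  ∃ c : Finset (Fin n) → ℝ, ∀ x : Fin n → Bool,
    P x = ((∑ S : Finset (Fin n) with S.card ≤ d,
      c S * ∏ i ∈ S, (if x i then (1 : ℝ) else 0) : ℝ) : UnitAddCircle)

/-- The function `f / 2` with values in `{0, 1/2} ⊆ ℝ / ℤ`. -/
noncomputable def halfEmbed {n : ℕ} (f : BoolFun n) : TorusFun n :=
  fun x => (((if f x then (1 : ℝ) else 0) / 2 : ℝ) : UnitAddCircle)

/-- `P` is an `ε`-approximation of `f`. -/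
def Approximates {n : ℕ} (ε : ℝ) (P : TorusFun n) (f : BoolFun n) : Prop :=
  ‖P - halfEmbed f‖ ≤ ε

/-- The toroidal `ε`-approximation degree of `f`.  For `ε > 0` the set below is not empty, so the
infimum is attained (`toroidalDegree_mem`). -/
noncomputable def toroidalDegree {n : ℕ} (ε : ℝ) (f : BoolFun n) : ℕ :=
  sInf {d : ℕ | ∃ P : TorusFun n, IsTorusPoly d P ∧ Approximates ε P f}

/-- If `z` is the representative in `[-1/2, 1/2)` of a point of the torus, the norm of that point
is `|z|`. -/
theorem norm_torus_coe {z : ℝ} (h1 : -(1 / 2) ≤ z) (h2 : z < 1 / 2) :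
    ‖(z : UnitAddCircle)‖ = |z| := by
  have h : |z| ≤ |(1 : ℝ)| / 2 := by
    rw [abs_one]; exact abs_le.2 ⟨h1, h2.le⟩
  exact (AddCircle.norm_coe_eq_abs_iff (1 : ℝ) one_ne_zero).2 h

theorem norm_le_iff {n : ℕ} (F : TorusFun n) (ε : ℝ) : ‖F‖ ≤ ε ↔ ∀ x, ‖F x‖ ≤ ε :=
  pi_norm_le_iff_of_nonempty F

/-- Every real function on the cube is a multilinear polynomial. -/
theorem exists_coeff {n : ℕ} (g : Finset (Fin n) → ℝ) :
    ∃ c : Finset (Fin n) → ℝ, ∀ T, ∑ S ∈ T.powerset, c S = g T := by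
  let c : Finset (Fin n) → ℝ := WellFounded.fix (r := (· ⊂ ·)) wellFounded_lt
    (fun T ih => g T - ∑ S ∈ T.ssubsets.attach, ih S.1 (Finset.mem_ssubsets.1 S.2))
  refine ⟨c, fun T => ?_⟩
  have hc : c T = g T - ∑ S ∈ T.ssubsets, c S := by
    rw [← Finset.sum_attach T.ssubsets]
    exact WellFounded.fix_eq _ _ T
  have hp : T.powerset = insert T T.ssubsets := by
    rw [Finset.ssubsets, Finset.insert_erase (Finset.mem_powerset_self T)]
  rw [hp, Finset.sum_insert (by simp), hc]
  ring

theorem toroidalDegree_mem {n : ℕ} {ε : ℝ} (hε : 0 < ε) (f : BoolFun n) :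
    ∃ P : TorusFun n, IsTorusPoly (toroidalDegree ε f) P ∧ Approximates ε P f := by
  refine Nat.sInf_mem (s := {d : ℕ | ∃ P : TorusFun n, IsTorusPoly d P ∧ Approximates ε P f})
    ⟨n, halfEmbed f, ?_, ?_⟩
  · obtain ⟨c, hc⟩ := exists_coeff
      (fun T : Finset (Fin n) => (if f (fun i => decide (i ∈ T)) then (1 : ℝ) else 0) / 2)
    refine ⟨c, fun x => ?_⟩
    have h := hc (Finset.univ.filter fun i => x i = true)
    have hx : (fun i => decide (i ∈ Finset.univ.filter fun i => x i = true)) = x := by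
      funext i; simp
    simp only [hx] at h
    unfold halfEmbed
    rw [← h]
    congr 1
    have hu : (Finset.univ.filter fun S : Finset (Fin n) => S.card ≤ n) = Finset.univ :=
      Finset.filter_true_of_mem fun S _ => by simpa using Finset.card_le_univ S
    rw [hu, ← Finset.sum_subset (Finset.subset_univ (Finset.univ.filter fun i => x i = true).powerset)]
    · refine Finset.sum_congr rfl fun S hS => ?_
      rw [Finset.prod_eq_one, mul_one]
      intro i hi
      have := Finset.mem_powerset.1 hS hi
      simp at this
      simp [this]
    · intro S _ hS
      rw [Finset.mem_powerset, Finset.not_subset] at hS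
      obtain ⟨i, hi, hxi⟩ := hS
      rw [Finset.prod_eq_zero hi (by simp at hxi; simp [hxi]), mul_zero]
  · simpa [Approximates] using hε.le

/-! ## Circuits with AND, OR, NOT and MOD gates, and the class AC⁰[p] -/

/-- A gate whose inputs are taken from the wires `α`.  AND, OR and MOD gates have unbounded fan-in,
and a wire may enter a gate several times. -/
inductive Gate (α : Type) : Type where
  | and (inputs : List α) : Gate α
  | or (inputs : List α) : Gate α
  | not (input : α) : Gate α
  | mod (inputs : List α) : Gate α

namespace Gate

/-- The list of input wires of a gate. -/
def inputs {α : Type} : Gate α → List α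
  | and l => l
  | or l => l
  | not a => [a]
  | mod l => l

/-- The output of a gate, given the values of the wires.  The `mod` gate is `MOD_p`: it outputs `1`
if and only if the sum of its inputs is not congruent to `0` modulo `p`. -/
def eval {α : Type} (p : ℕ) (v : α → Bool) : Gate α → Bool
  | and l => l.all v
  | or l => l.any v
  | not a => !(v a)
  | mod l => decide ((l.map fun a => (v a).toNat).sum % p ≠ 0)

end Gate

/-- The gates of a circuit with `n` input variables and `s` gates, in a topological order: the inputs
of a gate are input variables and outputs of earlier gates (of arbitrary fan-out). -/
inductive Gates (n : ℕ) : ℕ → Type where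
  | nil : Gates n 0
  | snoc {s : ℕ} (G : Gates n s) (g : Gate (Fin n ⊕ Fin s)) : Gates n (s + 1)

namespace Gates

/-- The values computed by all gates on the input `x`. -/
def eval {n : ℕ} (p : ℕ) (x : Fin n → Bool) : {s : ℕ} → Gates n s → Fin s → Bool
  | _, nil => Fin.elim0
  | _, snoc G g => Fin.snoc (α := fun _ => Bool) (eval p x G) (g.eval p (Sum.elim x (eval p x G)))

/-- The depth of every gate: the largest number of gates on a path that ends in it. -/
def depth {n : ℕ} : {s : ℕ} → Gates n s → Fin s → ℕ
  | _, nil => Fin.elim0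
  | _, snoc G g => Fin.snoc (α := fun _ => ℕ) (depth G)
      ((g.inputs.map (Sum.elim (fun _ => 0) (depth G))).foldr max 0 + 1)

end Gates

/-- A circuit with `n` input variables.  Its size is its number of gates. -/
structure Circuit (n : ℕ) where
  size : ℕ
  gates : Gates n size
  output : Fin n ⊕ Fin size

namespace Circuit

/-- The Boolean function computed by a circuit whose `mod` gates are `MOD_p` gates. -/
def eval {n : ℕ} (p : ℕ) (K : Circuit n) : BoolFun n :=
  fun x => Sum.elim x (K.gates.eval p x) K.output

/-- The depth of a circuit: the largest number of gates on a path that ends in the output. -/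
def depth {n : ℕ} (K : Circuit n) : ℕ :=
  Sum.elim (fun _ => 0) K.gates.depth K.output

end Circuit

/-- `f` is computed by a circuit of depth at most `d` and size at most `s` with AND, OR, NOT and
`MOD_p` gates. -/
def HasCircuit {n : ℕ} (p d s : ℕ) (f : BoolFun n) : Prop :=
  ∃ K : Circuit n, K.depth ≤ d ∧ K.size ≤ s ∧ K.eval p = f

/-- The (nonuniform) class AC⁰[p]: the families `f_n : {0,1}^n → {0,1}` computed by circuits of
constant depth and polynomial size with AND, OR, NOT and `MOD_p` gates. -/
def AC0 (p : ℕ) : Set ((n : ℕ) → BoolFun n) :=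
  {f | ∃ (d : ℕ) (q : Polynomial ℕ), ∀ n, HasCircuit p d (q.eval n) (f n)}

end TorusApprox

/-! The approximation is a vote count divided by a prime power. Let N = p ^ K ≥ (n + 2) / ε, and
take ⌊N / 2⌋ integer polynomials A_i, each congruent modulo N to a {0, 1}-valued vote on f(x), such
that at every x at most n + 1 votes are wrong. Modulo 1, ∑ A_i / N is then the number of 1-votes
over N, which lies within (n + 2) / N of f(x) / 2.

The votes come from the Razborov–Smolensky method: for every weight on the cube, f agrees with a
low-degree polynomial over F_p outside relative weight s / 2 ^ k (`exists_approx_of_hasCircuit`).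
Because this holds for all weights, multiplicative weights yield a family with few errors at each
single point (`exists_family_few_errors`). Lifting a vote from modulus p to p ^ K multiplies the
degree by K ^ 2 (`exists_int_amplification`). `toroidalDegree_le_of_hasCircuit` combines these; K
and k of order log(n / ε) suffice. -/

namespace TorusApprox

open Finset

/-! ## Functions on the cube of bounded degree -/

/-- The monomial `∏_{i ∈ S} x_i` as a function on the cube. -/
def monom (R : Type*) [CommRing R] {n : ℕ} (S : Finset (Fin n)) (x : Fin n → Bool) : R :=
  ∏ i ∈ S, if x i then 1 else 0

/-- The functions on the cube that are multilinear polynomials of degree at most `D`. -/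
def lowDegree (R : Type*) [CommRing R] (n D : ℕ) : Submodule R ((Fin n → Bool) → R) :=
  Submodule.span R (monom R '' {S : Finset (Fin n) | S.card ≤ D})

section LowDegree

variable {R : Type*} [CommRing R] {n : ℕ}

theorem monom_mem_lowDegree {D : ℕ} {S : Finset (Fin n)} (h : S.card ≤ D) :
    monom R S ∈ lowDegree R n D :=
  Submodule.subset_span ⟨S, h, rfl⟩

theorem lowDegree_mono {D E : ℕ} (h : D ≤ E) : lowDegree R n D ≤ lowDegree R n E :=
  Submodule.span_mono (Set.image_mono fun _ hS => le_trans hS h)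

theorem one_mem_lowDegree (D : ℕ) : (1 : (Fin n → Bool) → R) ∈ lowDegree R n D := by
  have h : (monom R (∅ : Finset (Fin n))) = 1 := by
    funext x; simp [monom]
  rw [← h]
  exact monom_mem_lowDegree (by simp)

theorem coord_mem_lowDegree (i : Fin n) {D : ℕ} (hD : 1 ≤ D) :
    (fun x => if x i then 1 else 0 : (Fin n → Bool) → R) ∈ lowDegree R n D := by
  have h : (monom R ({i} : Finset (Fin n))) = fun x => if x i then 1 else 0 := by
    funext x; simp [monom]
  rw [← h]
  exact monom_mem_lowDegree (by simpa using hD)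

/-- On the cube x_i ^ 2 = x_i, so products of multilinear monomials stay multilinear. -/
theorem monom_mul (S T : Finset (Fin n)) : monom R S * monom R T = monom R (S ∪ T) := by
  funext x
  simp only [monom, Pi.mul_apply, Finset.prod_ite_zero, Finset.prod_const_one]
  simp only [Finset.mem_union, or_imp, forall_and, ite_and]
  split_ifs <;> simp

theorem mul_mem_lowDegree {D E : ℕ} {F G : (Fin n → Bool) → R} (hF : F ∈ lowDegree R n D)
    (hG : G ∈ lowDegree R n E) : F * G ∈ lowDegree R n (D + E) := by
  have h : lowDegree R n D * lowDegree R n E ≤ lowDegree R n (D + E) := by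
    unfold lowDegree
    rw [Submodule.span_mul_span]
    refine Submodule.span_mono ?_
    rintro _ ⟨_, ⟨S, hS, rfl⟩, _, ⟨T, hT, rfl⟩, rfl⟩
    exact ⟨S ∪ T, (Finset.card_union_le S T).trans (add_le_add hS hT), (monom_mul S T).symm⟩
  exact h (Submodule.mul_mem_mul hF hG)

theorem pow_mem_lowDegree {D : ℕ} {F : (Fin n → Bool) → R} (hF : F ∈ lowDegree R n D) (k : ℕ) :
    F ^ k ∈ lowDegree R n (k * D) := by
  induction k with
  | zero => simpa using one_mem_lowDegree 0
  | succ k ih =>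
    rw [pow_succ, Nat.succ_mul]
    exact mul_mem_lowDegree ih hF

/-- Explicit coefficients are needed twice: to lift from `ZMod p` to ℤ, and to divide by N on the
torus. -/
theorem exists_coeff_of_mem_lowDegree {D : ℕ} {F : (Fin n → Bool) → R}
    (hF : F ∈ lowDegree R n D) : ∃ c : Finset (Fin n) → R,
      ∀ x, F x = ∑ S : Finset (Fin n) with S.card ≤ D, c S * monom R S x := by
  refine Submodule.span_induction (p := fun F _ => ∃ c : Finset (Fin n) → R,
      ∀ x, F x = ∑ S : Finset (Fin n) with S.card ≤ D, c S * monom R S x) ?_ ?_ ?_ ?_ hF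
  · rintro _ ⟨S, hS, rfl⟩
    refine ⟨Pi.single S 1, fun x => ?_⟩
    rw [Finset.sum_eq_single_of_mem S (by simpa using hS)]
    · simp
    · intro T _ hT
      simp [hT]
  · exact ⟨0, by simp⟩
  · rintro F G - - ⟨c, hc⟩ ⟨e, he⟩
    exact ⟨c + e, fun x => by simp [hc, he, add_mul, Finset.sum_add_distrib]⟩
  · rintro a F - ⟨c, hc⟩
    exact ⟨a • c, fun x => by simp [hc, mul_assoc, Finset.mul_sum]⟩

end LowDegree

/-! ## Modulus amplification -/

/-- A function of degree `D` modulo `p` with values in `{0, 1}` is congruent modulo `p ^ k` to an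
integer polynomial of degree `k ^ 2 * D`. -/
theorem exists_int_amplification {n D p : ℕ} (k : ℕ)
    {F : (Fin n → Bool) → ZMod p} [NeZero p] (hF : F ∈ lowDegree (ZMod p) n D)
    (hF01 : ∀ x, F x = 0 ∨ F x = 1) :
    ∃ A ∈ lowDegree ℤ n (k * (k * D)),
      ∀ x, ((p : ℤ) ^ k) ∣ A x - (if F x = 1 then 1 else 0) := by
  obtain ⟨c, hc⟩ := exists_coeff_of_mem_lowDegree hF
  let G : (Fin n → Bool) → ℤ := ∑ S : Finset (Fin n) with S.card ≤ D, ((c S).val : ℤ) • monom ℤ S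
  have hG : G ∈ lowDegree ℤ n D := Submodule.sum_mem _ fun S hS =>
    Submodule.smul_mem _ _ (monom_mem_lowDegree (by simpa using hS))
  have hGF : ∀ x, ((G x : ℤ) : ZMod p) = F x := by
    intro x
    rw [hc]
    simp only [G, monom, Finset.sum_apply, Pi.smul_apply, smul_eq_mul]
    push_cast
    simp only [ZMod.natCast_zmod_val]
  -- If p ∣ G x, then p ^ k divides y = G x ^ k, and y divides 1 - (1 - y) ^ k. If G x ≡ 1 mod p,
  -- then p divides 1 - G x ^ k, so p ^ k divides its k-th power.
  refine ⟨1 - (1 - G ^ k) ^ k, Submodule.sub_mem _ (one_mem_lowDegree _)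
    (pow_mem_lowDegree (Submodule.sub_mem _ (one_mem_lowDegree _) (pow_mem_lowDegree hG k)) k),
    fun x => ?_⟩
  simp only [Pi.sub_apply, Pi.pow_apply, Pi.one_apply]
  by_cases h1 : F x = 1
  · rw [if_pos h1, sub_sub_cancel_left, dvd_neg]
    refine pow_dvd_pow_of_dvd ?_ k
    rw [← ZMod.intCast_zmod_eq_zero_iff_dvd]
    push_cast
    rw [hGF, h1]
    simp
  · have h0 := (hF01 x).resolve_right h1
    rw [if_neg h1, sub_zero]
    have hd : (p : ℤ) ^ k ∣ G x ^ k := pow_dvd_pow_of_dvd (by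
      rw [← ZMod.intCast_zmod_eq_zero_iff_dvd, hGF, h0]) k
    have := sub_dvd_pow_sub_pow (1 : ℤ) (1 - G x ^ k) k
    rw [one_pow, sub_sub_cancel] at this
    exact hd.trans this

/-! ## Approximation of gates by polynomials over a prime field -/

theorem two_mul_sum_filter_le_or {X : Type*} (T : Finset X) (w : X → ℕ) (a b : X → Prop)
    [DecidablePred a] [DecidablePred b] (h : ∀ x ∈ T, ¬(a x ∧ b x)) :
    2 * ∑ x ∈ T with a x, w x ≤ ∑ x ∈ T, w x ∨ 2 * ∑ x ∈ T with b x, w x ≤ ∑ x ∈ T, w x := by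
  have := Classical.decEq X
  have hd : Disjoint (T.filter a) (T.filter b) := by
    rw [Finset.disjoint_left]
    intro x hx hy
    simp only [mem_filter] at hx hy
    exact h x hx.1 ⟨hx.2, hy.2⟩
  have : ∑ x ∈ T with a x, w x + ∑ x ∈ T with b x, w x ≤ ∑ x ∈ T, w x := by
    rw [← Finset.sum_union hd]
    exact Finset.sum_le_sum_of_subset
      (Finset.union_subset (filter_subset a T) (filter_subset b T))
  omega

open Classical in
/-- For functions `fs` with values in a field there is a linear combination that vanishes on at
most half of the points at which some function in `fs` does not vanish. -/
theorem exists_linearCombination_ne_zero {X K : Type*} [Field K] (T : Finset X) (w : X → ℕ)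
    (fs : List (X → K)) : ∀ h : X → K, ∃ u ∈ Submodule.span K {f | f ∈ fs},
      2 * ∑ x ∈ T with ((∃ f ∈ fs, f x ≠ 0) ∧ h x + u x = 0), w x ≤
        ∑ x ∈ T with (∃ f ∈ fs, f x ≠ 0), w x := by
  induction fs with
  | nil => exact fun h => ⟨0, Submodule.zero_mem _, by simp⟩
  | cons f fs ih =>
    intro h
    -- Coefficients are fixed one at a time. On `T₀` the tail contributes nothing, so `c` alone
    -- decides, and `c = 0` and `c = 1` cannot both give zero since `f x ≠ 0`. Points where the tail
    -- is not all zero are left to the induction, whose offset absorbs `c • f`.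
    let T₀ := T.filter fun x => (∀ g ∈ fs, g x = 0) ∧ f x ≠ 0
    have hc : ∃ c : K, 2 * ∑ x ∈ T₀ with h x + c * f x = 0, w x ≤ ∑ x ∈ T₀, w x := by
      rcases two_mul_sum_filter_le_or T₀ w (fun x => h x + 0 * f x = 0)
        (fun x => h x + 1 * f x = 0) (by
          rintro x hx ⟨h1, h2⟩
          simp only [T₀, mem_filter] at hx
          simp only [zero_mul, add_zero] at h1
          rw [h1, zero_add, one_mul] at h2
          exact hx.2.2 h2) with h1 | h1
      exacts [⟨0, h1⟩, ⟨1, h1⟩]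
    obtain ⟨c, hc⟩ := hc
    obtain ⟨u, hu, hu2⟩ := ih (h + c • f)
    have hzero : ∀ x, (∀ g ∈ fs, g x = 0) → u x = 0 := by
      intro x hx
      have : Submodule.span K {f | f ∈ fs} ≤ LinearMap.ker (LinearMap.proj (R := K) x) :=
        Submodule.span_le.2 fun g hg => hx g hg
      exact this hu
    refine ⟨c • f + u, Submodule.add_mem _
      (Submodule.smul_mem _ _ (Submodule.subset_span (by simp)))
      (Submodule.span_mono (fun g hg => List.mem_cons_of_mem _ hg) hu), ?_⟩
    have hsplit : ∀ q : X → Prop,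
        ∑ x ∈ T with ((∃ g ∈ f :: fs, g x ≠ 0) ∧ q x), w x =
          ∑ x ∈ T with ((∃ g ∈ fs, g x ≠ 0) ∧ q x), w x + ∑ x ∈ T₀ with q x, w x := by
      intro q
      rw [← Finset.sum_union]
      · refine Finset.sum_congr ?_ fun _ _ => rfl
        ext x
        simp only [T₀, mem_filter, mem_union, List.exists_mem_cons_iff]
        by_cases hx : ∃ g ∈ fs, g x ≠ 0
        · simp only [hx, or_true]; tauto
        · have : ∀ g ∈ fs, g x = 0 := by push Not at hx; exact hx
          simp only [hx, or_false]; tauto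
      · rw [Finset.disjoint_left]
        intro x hx hy
        simp only [T₀, mem_filter] at hx hy
        obtain ⟨g, hg, hgx⟩ := hx.2.1
        exact hgx (hy.1.2.1 g hg)
    have h1 := hsplit fun _ => True
    have h2 := hsplit fun x => h x + (c • f + u) x = 0
    simp only [and_true, filter_true] at h1
    rw [h1, h2]
    have e1 : ∑ x ∈ T₀ with h x + (c • f + u) x = 0, w x =
        ∑ x ∈ T₀ with h x + c * f x = 0, w x := by
      refine Finset.sum_congr (Finset.filter_congr fun x hx => ?_) fun _ _ => rfl
      simp only [T₀, mem_filter] at hx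
      simp [hzero x hx.2.1]
    rw [e1]
    simp only [Pi.add_apply, Pi.smul_apply, smul_eq_mul] at hu2 ⊢
    simp only [add_assoc] at hu2 ⊢
    omega

open Classical in
/-- A polynomial of degree `k * ((p - 1) * D)` that is `1` where all functions in `fs` vanish, and `0`
at all but a fraction `2 ^ (-k)` of the other points. -/
theorem exists_approx_nor {n p D : ℕ} [Fact p.Prime] (w : (Fin n → Bool) → ℕ)
    (fs : List ((Fin n → Bool) → ZMod p)) (hfs : ∀ f ∈ fs, f ∈ lowDegree (ZMod p) n D) (k : ℕ) :
    ∃ Q ∈ lowDegree (ZMod p) n (k * ((p - 1) * D)),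
      (∀ x, (∀ f ∈ fs, f x = 0) → Q x = 1) ∧
      2 ^ k * ∑ x with ((∃ f ∈ fs, f x ≠ 0) ∧ Q x ≠ 0), w x ≤ ∑ x, w x := by
  have hp : p.Prime := Fact.out
  induction k with
  | zero =>
    refine ⟨1, one_mem_lowDegree _, fun x _ => rfl, ?_⟩
    rw [pow_zero, one_mul]
    exact Finset.sum_le_sum_of_subset (filter_subset _ _)
  | succ k ih =>
    obtain ⟨Q, hQ, hQ1, hQ2⟩ := ih
    -- Only points with `Q x ≠ 0` count, so the weight of the surviving errors halves each time. By
    -- Fermat, the factor 1 - u ^ (p - 1) is 0 exactly where u ≠ 0.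
    obtain ⟨u, hu, hu2⟩ := exists_linearCombination_ne_zero
      (univ.filter fun x => Q x ≠ 0) w fs 0
    have huD : u ∈ lowDegree (ZMod p) n D := Submodule.span_le.2 hfs hu
    have hzero : ∀ x, (∀ g ∈ fs, g x = 0) → u x = 0 := by
      intro x hx
      have : Submodule.span (ZMod p) {f | f ∈ fs} ≤
          LinearMap.ker (LinearMap.proj (R := ZMod p) x) :=
        Submodule.span_le.2 fun g hg => hx g hg
      exact this hu
    refine ⟨Q * (1 - u ^ (p - 1)), ?_, fun x hx => ?_, ?_⟩
    · rw [Nat.succ_mul]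
      exact mul_mem_lowDegree hQ
        (Submodule.sub_mem _ (one_mem_lowDegree _) (pow_mem_lowDegree huD _))
    · have : p - 1 ≠ 0 := by have := hp.two_le; omega
      simp [hQ1 x hx, hzero x hx, zero_pow this]
    · rw [filter_filter, filter_filter] at hu2
      have hle : ∑ x with ((∃ f ∈ fs, f x ≠ 0) ∧ (Q * (1 - u ^ (p - 1))) x ≠ 0), w x ≤
          ∑ x with (Q x ≠ 0 ∧ ((∃ f ∈ fs, f x ≠ 0) ∧
            (0 : (Fin n → Bool) → ZMod p) x + u x = 0)), w x := by
        refine Finset.sum_le_sum_of_subset fun x hx => ?_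
        simp only [mem_filter, mem_univ, true_and, Pi.mul_apply, Pi.sub_apply, Pi.one_apply,
          Pi.pow_apply, Pi.zero_apply, zero_add] at hx ⊢
        refine ⟨left_ne_zero_of_mul hx.2, hx.1, ?_⟩
        by_contra hne
        exact right_ne_zero_of_mul hx.2 (by rw [ZMod.pow_card_sub_one_eq_one hne, sub_self])
      simp only [and_comm (a := Q _ ≠ 0) (b := ∃ f ∈ fs, f _ ≠ 0)] at hu2
      replace hle : 2 * ∑ x with ((∃ f ∈ fs, f x ≠ 0) ∧ (Q * (1 - u ^ (p - 1))) x ≠ 0), w x ≤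
          ∑ x with ((∃ f ∈ fs, f x ≠ 0) ∧ Q x ≠ 0), w x := by
        refine (Nat.mul_le_mul_left 2 hle).trans (le_of_eq_of_le ?_ hu2)
        congr!
      rw [pow_succ, mul_assoc]
      exact (Nat.mul_le_mul_left _ hle).trans hQ2

/-- The value `0` or `1` of a Boolean in a ring. -/
def bit (R : Type*) [CommRing R] (b : Bool) : R := if b then 1 else 0

theorem bit_not {R : Type*} [CommRing R] (b : Bool) : bit R (!b) = 1 - bit R b := by
  cases b <;> simp [bit]

theorem natCast_toNat_eq_bit {R : Type*} [CommRing R] (b : Bool) :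
    ((b.toNat : ℕ) : R) = bit R b := by
  cases b <;> simp [bit]

open Classical in
/-- Approximation of one gate, given polynomials for its inputs. -/
theorem exists_approx_gate {n p D k : ℕ} [Fact p.Prime] (hk : 1 ≤ k) (w : (Fin n → Bool) → ℕ)
    {α : Type} (g : Gate α) (v : (Fin n → Bool) → α → Bool) (P : α → (Fin n → Bool) → ZMod p)
    (hP : ∀ a ∈ g.inputs, P a ∈ lowDegree (ZMod p) n D) :
    ∃ Q ∈ lowDegree (ZMod p) n (k * ((p - 1) * D)),
      2 ^ k * ∑ x with ((∀ a ∈ g.inputs, P a x = bit (ZMod p) (v x a)) ∧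
        Q x ≠ bit (ZMod p) (g.eval p (v x))), w x ≤ ∑ x, w x := by
  have hp1 : 1 ≤ p - 1 := by have := (Fact.out : p.Prime).two_le; omega
  have hDk : (p - 1) * D ≤ k * ((p - 1) * D) := Nat.le_mul_of_pos_left _ hk
  have hD : D ≤ (p - 1) * D := Nat.le_mul_of_pos_left _ hp1
  have exact_of : ∀ Q : (Fin n → Bool) → ZMod p,
      (∀ x, (∀ a ∈ g.inputs, P a x = bit (ZMod p) (v x a)) →
        Q x = bit (ZMod p) (g.eval p (v x))) →
      2 ^ k * ∑ x with ((∀ a ∈ g.inputs, P a x = bit (ZMod p) (v x a)) ∧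
        Q x ≠ bit (ZMod p) (g.eval p (v x))), w x ≤ ∑ x, w x := by
    intro Q hQ
    rw [Finset.filter_false_of_mem fun x _ h => h.2 (hQ x h.1)]
    simp
  have le_of : ∀ (Q R : (Fin n → Bool) → ZMod p) (fs : List ((Fin n → Bool) → ZMod p)),
      2 ^ k * ∑ x with ((∃ f ∈ fs, f x ≠ 0) ∧ R x ≠ 0), w x ≤ ∑ x, w x →
      (∀ x, (∀ a ∈ g.inputs, P a x = bit (ZMod p) (v x a)) →
        Q x ≠ bit (ZMod p) (g.eval p (v x)) → (∃ f ∈ fs, f x ≠ 0) ∧ R x ≠ 0) →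
      2 ^ k * ∑ x with ((∀ a ∈ g.inputs, P a x = bit (ZMod p) (v x a)) ∧
        Q x ≠ bit (ZMod p) (g.eval p (v x))), w x ≤ ∑ x, w x := by
    intro Q R fs h1 h2
    refine (Nat.mul_le_mul_left _ (Finset.sum_le_sum_of_subset fun x hx => ?_)).trans h1
    simp only [mem_filter, mem_univ, true_and] at hx ⊢
    exact h2 x hx.1 hx.2
  cases g with
  | and l =>
    simp only [Gate.inputs] at *
    -- AND is the NOR of the negated inputs; OR is the negation of NOR.
    obtain ⟨Q, hQ, hQ1, hQ2⟩ := exists_approx_nor w (l.map fun a => 1 - P a) (D := D) (by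
      simp only [List.mem_map]
      rintro _ ⟨a, ha, rfl⟩
      exact Submodule.sub_mem _ (one_mem_lowDegree _) (hP a ha)) k
    refine ⟨Q, hQ, le_of Q Q _ hQ2 fun x hx hne => ?_⟩
    by_cases hl : ∀ a ∈ l, v x a = true
    · refine absurd ?_ hne
      rw [hQ1 x (by
        simp only [List.mem_map]
        rintro _ ⟨a, ha, rfl⟩
        simp [hx a ha, hl a ha, bit])]
      simp [Gate.eval, bit, List.all_eq_true.2 hl]
    · have he : Gate.eval p (v x) (.and l) = false := by
        rw [Gate.eval, List.all_eq_false]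
        push Not at hl
        exact hl
      rw [he] at hne
      push Not at hl
      obtain ⟨a, ha, hva⟩ := hl
      refine ⟨⟨1 - P a, List.mem_map.2 ⟨a, ha, rfl⟩, ?_⟩, by simpa [bit] using hne⟩
      simp [hx a ha, hva, bit]
  | or l =>
    simp only [Gate.inputs] at *
    obtain ⟨Q, hQ, hQ1, hQ2⟩ := exists_approx_nor w (l.map P) (D := D) (by
      simp only [List.mem_map]
      rintro _ ⟨a, ha, rfl⟩
      exact hP a ha) k
    refine ⟨1 - Q, Submodule.sub_mem _ (one_mem_lowDegree _) hQ,
      le_of _ Q _ hQ2 fun x hx hne => ?_⟩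
    by_cases hl : ∀ a ∈ l, v x a = false
    · refine absurd ?_ hne
      have he : Gate.eval p (v x) (.or l) = false := by
        rw [Gate.eval, List.any_eq_false]
        intro a ha
        simp [hl a ha]
      rw [he, Pi.sub_apply, hQ1 x (by
        simp only [List.mem_map]
        rintro _ ⟨a, ha, rfl⟩
        simp [hx a ha, hl a ha, bit])]
      simp [bit]
    · push Not at hl
      obtain ⟨a, ha, hva⟩ := hl
      rw [ne_eq, Bool.not_eq_false] at hva
      have he : Gate.eval p (v x) (.or l) = true := by
        rw [Gate.eval, List.any_eq_true]
        exact ⟨a, ha, hva⟩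
      rw [he] at hne
      refine ⟨⟨P a, List.mem_map.2 ⟨a, ha, rfl⟩, ?_⟩, by simpa [bit] using hne⟩
      simp [hx a ha, hva, bit]
  | not a =>
    simp only [Gate.inputs, List.mem_singleton, forall_eq] at *
    refine ⟨1 - P a, Submodule.sub_mem _ (one_mem_lowDegree _)
      (lowDegree_mono (hD.trans hDk) hP), exact_of _ fun x hx => ?_⟩
    simp [Gate.eval, bit_not, hx]
  | mod l =>
    simp only [Gate.inputs] at *
    have hsum : (l.map P).sum ∈ lowDegree (ZMod p) n D := by
      apply list_sum_mem
      simp only [List.mem_map]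
      rintro _ ⟨a, ha, rfl⟩
      exact hP a ha
    -- By Fermat, the power p - 1 is the exact indicator of a nonzero sum modulo p.
    refine ⟨(l.map P).sum ^ (p - 1), lowDegree_mono hDk (pow_mem_lowDegree hsum _),
      exact_of _ fun x hx => ?_⟩
    · have hs : (l.map P).sum x = (((l.map fun a => (v x a).toNat).sum : ℕ) : ZMod p) := by
        rw [Pi.list_sum_apply]
        push_cast
        rw [List.map_map, List.map_map]
        congr 1
        refine List.map_congr_left fun a ha => ?_
        simp [hx a ha, natCast_toNat_eq_bit]
      rw [Pi.pow_apply, hs, Gate.eval]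
      by_cases h0 : (l.map fun a => (v x a).toNat).sum % p = 0
      · have : (((l.map fun a => (v x a).toNat).sum : ℕ) : ZMod p) = 0 :=
          (ZMod.natCast_eq_zero_iff _ _).2 (Nat.dvd_of_mod_eq_zero h0)
        rw [this, zero_pow (by omega)]
        simp [h0, bit]
      · have : (((l.map fun a => (v x a).toNat).sum : ℕ) : ZMod p) ≠ 0 := fun h =>
          h0 (Nat.mod_eq_zero_of_dvd ((ZMod.natCast_eq_zero_iff _ _).1 h))
        rw [ZMod.pow_card_sub_one_eq_one this]
        simp [h0, bit]

theorem le_foldr_max {l : List ℕ} {a : ℕ} (ha : a ∈ l) : a ≤ l.foldr max 0 := by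
  induction l with
  | nil => simp at ha
  | cons b l ih =>
    rcases List.mem_cons.1 ha with rfl | h
    · exact le_max_left _ _
    · exact (ih h).trans (le_max_right _ _)

open Classical in
/-- Approximation of all gates of a circuit: for every weight on the cube there are polynomials that
compute all gates correctly except on a set of relative weight at most `s * 2 ^ (-k)`. -/
theorem exists_approx_gates {n p k : ℕ} [Fact p.Prime] (hk : 1 ≤ k) (w : (Fin n → Bool) → ℕ)
    {s : ℕ} (G : Gates n s) :
    ∃ P : Fin s → (Fin n → Bool) → ZMod p,
      (∀ g, P g ∈ lowDegree (ZMod p) n ((k * (p - 1)) ^ G.depth g)) ∧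
      2 ^ k * ∑ x with (∃ g, P g x ≠ bit (ZMod p) (G.eval p x g)), w x ≤ s * ∑ x, w x := by
  have hp1 : 1 ≤ p - 1 := by have := (Fact.out : p.Prime).two_le; omega
  have hB : 1 ≤ k * (p - 1) := Nat.mul_pos hk hp1
  induction G with
  | nil => exact ⟨Fin.elim0, fun g => g.elim0, by simp⟩
  | @snoc s G g ih =>
    obtain ⟨P, hPD, hP⟩ := ih
    set m := (g.inputs.map (Sum.elim (fun _ => 0) G.depth)).foldr max 0 with hm
    let P' : Fin n ⊕ Fin s → (Fin n → Bool) → ZMod p :=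
      Sum.elim (fun i x => bit (ZMod p) (x i)) P
    have hP' : ∀ a ∈ g.inputs, P' a ∈ lowDegree (ZMod p) n ((k * (p - 1)) ^ m) := by
      intro a ha
      rcases a with i | j
      · exact coord_mem_lowDegree i (Nat.one_le_pow _ _ hB)
      · exact lowDegree_mono (Nat.pow_le_pow_right hB (le_foldr_max (List.mem_map.2 ⟨_, ha, rfl⟩)))
          (hPD j)
    obtain ⟨Q, hQD, hQ⟩ := exists_approx_gate hk w g
      (fun x => Sum.elim x (G.eval p x)) P' hP'
    refine ⟨Fin.snoc (α := fun _ => (Fin n → Bool) → ZMod p) P Q, fun j => ?_, ?_⟩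
    · refine Fin.lastCases ?_ (fun j => ?_) j
      · rw [Gates.depth, Fin.snoc_last, Fin.snoc_last, ← hm, pow_succ', mul_assoc]
        exact hQD
      · rw [Gates.depth, Fin.snoc_castSucc, Fin.snoc_castSucc]
        exact hPD j
    -- Union bound: either an earlier gate is already wrong, or all inputs of the new gate are right
    -- and its own approximation fails.
    · have hle : ∑ x with (∃ j, Fin.snoc (α := fun _ => (Fin n → Bool) → ZMod p) P Q j x ≠
            bit (ZMod p) ((Gates.snoc G g).eval p x j)), w x ≤
          ∑ x with (∃ j, P j x ≠ bit (ZMod p) (G.eval p x j)), w x +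
          ∑ x with ((∀ a ∈ g.inputs, P' a x = bit (ZMod p) (Sum.elim x (G.eval p x) a)) ∧
            Q x ≠ bit (ZMod p) (g.eval p (Sum.elim x (G.eval p x)))), w x := by
        refine le_trans (Finset.sum_le_sum_of_subset ?_)
          (Nat.le_of_add_right_le (Finset.sum_union_inter (f := w)).le)
        intro x hx
        simp only [mem_filter, mem_univ, true_and, mem_union] at hx ⊢
        by_cases hbad : ∃ j, P j x ≠ bit (ZMod p) (G.eval p x j)
        · exact Or.inl hbad
        · push Not at hbad
          refine Or.inr ⟨?_, ?_⟩
          · rintro (i | j) -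
            · rfl
            · exact hbad j
          · obtain ⟨j, hj⟩ := hx
            revert hj
            refine Fin.lastCases ?_ (fun j => ?_) j
            · rw [Gates.eval, Fin.snoc_last, Fin.snoc_last]
              exact id
            · rw [Gates.eval, Fin.snoc_castSucc, Fin.snoc_castSucc]
              exact fun hj => absurd (hbad j) hj
      rw [Nat.succ_mul]
      exact (Nat.mul_le_mul_left _ hle).trans (by rw [mul_add]; exact add_le_add hP (le_of_eq_of_le (by congr!) hQ))

open Classical in
/-- A function with a circuit of depth `d` and size `s` has, for every weight on the cube, a
`{0, 1}`-valued approximation of low degree modulo `p`. -/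
theorem exists_approx_of_hasCircuit {n p d s k : ℕ} [Fact p.Prime] (hk : 1 ≤ k) {f : BoolFun n}
    (hf : HasCircuit p d s f) (w : (Fin n → Bool) → ℕ) :
    ∃ F ∈ lowDegree (ZMod p) n ((p - 1) * (k * (p - 1)) ^ d), (∀ x, F x = 0 ∨ F x = 1) ∧
      2 ^ k * ∑ x with F x ≠ bit (ZMod p) (f x), w x ≤ s * ∑ x, w x := by
  obtain ⟨⟨S, G, o⟩, hd, hs, rfl⟩ := hf
  have hp1 : 1 ≤ p - 1 := by have := (Fact.out : p.Prime).two_le; omega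
  have hB : 1 ≤ k * (p - 1) := Nat.mul_pos hk hp1
  obtain ⟨P, hPD, hP⟩ := exists_approx_gates (p := p) hk w G
  let P' : Fin n ⊕ Fin S → (Fin n → Bool) → ZMod p :=
    Sum.elim (fun i x => bit (ZMod p) (x i)) P
  have hD : P' o ∈ lowDegree (ZMod p) n ((k * (p - 1)) ^ d) := by
    rcases o with i | j
    · exact coord_mem_lowDegree i (Nat.one_le_pow _ _ hB)
    · exact lowDegree_mono (Nat.pow_le_pow_right hB hd) (hPD j)
  -- The power p - 1 forces values in {0, 1} and leaves correct values unchanged.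
  refine ⟨P' o ^ (p - 1), pow_mem_lowDegree hD _, fun x => ?_, ?_⟩
  · by_cases h : P' o x = 0
    · left; rw [Pi.pow_apply, h, zero_pow (by omega)]
    · right; exact ZMod.pow_card_sub_one_eq_one h
  · refine le_trans ?_ (hP.trans (Nat.mul_le_mul_right _ hs))
    refine Nat.mul_le_mul_left _ (Finset.sum_le_sum_of_subset fun x hx => ?_)
    simp only [mem_filter, mem_univ, true_and] at hx ⊢
    by_contra hbad
    push Not at hbad
    refine hx ?_
    have : P' o x = bit (ZMod p) (Circuit.eval p ⟨S, G, o⟩ x) := by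
      rcases o with i | j
      · rfl
      · exact hbad j
    rw [Pi.pow_apply, this]
    cases Circuit.eval p ⟨S, G, o⟩ x
    · simp only [bit]; exact zero_pow (by omega)
    · simp [bit]

/-! ## Uniform approximation by multiplicative weights -/

open Classical in
/-- If every weight on a finite set `X` admits an approximation of `g` from a class `C` with relative
error at most `1 / t`, then there are `m` members of `C` for which the total potential
`∑ x, 2 ^ (number of errors at x)` is at most `(1 + 1 / t) ^ m * card X`. -/
theorem exists_family_potential_le {X Y : Type*} [Fintype X] (C : Set (X → Y)) (g : X → Y) (t : ℕ)
    (h : ∀ w : X → ℕ, ∃ F ∈ C, t * ∑ x with F x ≠ g x, w x ≤ ∑ x, w x) (m : ℕ) :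
    ∃ F : Fin m → X → Y, (∀ i, F i ∈ C) ∧
      t ^ m * ∑ x, 2 ^ (∑ i, if F i x ≠ g x then 1 else 0) ≤ (t + 1) ^ m * Fintype.card X := by
  induction m with
  | zero => exact ⟨Fin.elim0, fun i => i.elim0, by simp⟩
  | succ m ih =>
    obtain ⟨F, hF, hF2⟩ := ih
    -- The current potential serves as the weight: each error at x doubles the weight of x, so one
    -- round multiplies the total by at most 1 + 1 / t.
    obtain ⟨F₀, hC, h₀⟩ := h fun x => 2 ^ (∑ i, if F i x ≠ g x then 1 else 0)
    refine ⟨Fin.cons F₀ F, fun i => Fin.cases hC hF i, ?_⟩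
    simp only [Fin.sum_univ_succ, Fin.cons_zero, Fin.cons_succ]
    have hstep : ∑ x, 2 ^ ((if F₀ x ≠ g x then 1 else 0) + ∑ i, if F i x ≠ g x then 1 else 0) =
        ∑ x with F₀ x ≠ g x, 2 ^ (∑ i, if F i x ≠ g x then 1 else 0) +
          ∑ x, 2 ^ (∑ i, if F i x ≠ g x then 1 else 0) := by
      rw [Finset.sum_filter, ← Finset.sum_add_distrib]
      refine Finset.sum_congr rfl fun x _ => ?_
      by_cases hx : F₀ x = g x
      · simp [hx]
      · simp only [ne_eq, hx, not_false_eq_true, if_true]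
        ring
    rw [hstep]
    set Φ := ∑ x, 2 ^ (∑ i, if F i x ≠ g x then 1 else 0)
    set Ψ := ∑ x with F₀ x ≠ g x, 2 ^ (∑ i, if F i x ≠ g x then 1 else 0)
    calc t ^ (m + 1) * (Ψ + Φ) = t ^ m * (t * Ψ + t * Φ) := by ring
      _ ≤ t ^ m * (Φ + t * Φ) := Nat.mul_le_mul_left _ (Nat.add_le_add_right h₀ _)
      _ = (t + 1) * (t ^ m * Φ) := by ring
      _ ≤ (t + 1) * ((t + 1) ^ m * Fintype.card X) := Nat.mul_le_mul_left _ hF2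
      _ = _ := by ring

/-- This is (1 + 1 / t) ^ t ≤ e < 4. -/
theorem add_one_pow_lt (t : ℕ) (ht : 1 ≤ t) : (t + 1) ^ t < 4 * t ^ t := by
  have ht0 : (0 : ℝ) < t := by exact_mod_cast ht
  have h1 : (1 + 1 / (t : ℝ)) ^ t ≤ Real.exp 1 := by
    calc (1 + 1 / (t : ℝ)) ^ t ≤ Real.exp (1 / t) ^ t := by
          refine pow_le_pow_left₀ (by positivity) ?_ t
          rw [add_comm]
          exact Real.add_one_le_exp _
      _ = Real.exp 1 := by
          rw [← Real.exp_nat_mul]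
          congr 1
          field_simp
  have h2 : ((t : ℝ) + 1) ^ t = (1 + 1 / (t : ℝ)) ^ t * t ^ t := by
    rw [← mul_pow]
    congr 1
    field_simp
  have h3 : ((t : ℝ) + 1) ^ t < 4 * t ^ t := by
    rw [h2]
    refine mul_lt_mul_of_pos_right ?_ (by positivity)
    have := Real.exp_one_lt_d9
    linarith
  exact_mod_cast h3

open Classical in
-- After t rounds the potential is below 4 * 2 ^ n = 2 ^ (n + 2), and it bounds each summand 2 ^
-- (errors at x).
theorem exists_family_few_errors {n t : ℕ} (ht : 1 ≤ t) {Y : Type*} (C : Set ((Fin n → Bool) → Y))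
    (g : (Fin n → Bool) → Y)
    (h : ∀ w : (Fin n → Bool) → ℕ, ∃ F ∈ C, t * ∑ x with F x ≠ g x, w x ≤ ∑ x, w x) :
    ∃ F : Fin t → (Fin n → Bool) → Y, (∀ i, F i ∈ C) ∧
      ∀ x, ∑ i, (if F i x ≠ g x then 1 else 0) ≤ n + 1 := by
  obtain ⟨F, hF, hF2⟩ := exists_family_potential_le C g t h t
  refine ⟨F, hF, fun x => ?_⟩
  have h1 : 2 ^ (∑ i, if F i x ≠ g x then 1 else 0) ≤
      ∑ x, 2 ^ (∑ i, if F i x ≠ g x then 1 else 0) :=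
    Finset.single_le_sum (f := fun x => 2 ^ (∑ i, if F i x ≠ g x then 1 else 0))
      (fun _ _ => Nat.zero_le _) (mem_univ x)
  have h2 : t ^ t * 2 ^ (∑ i, if F i x ≠ g x then 1 else 0) < t ^ t * 2 ^ (n + 2) := by
    calc _ ≤ (t + 1) ^ t * Fintype.card (Fin n → Bool) :=
          (Nat.mul_le_mul_left _ h1).trans hF2
      _ < 4 * t ^ t * 2 ^ n := by
          rw [Fintype.card_fun, Fintype.card_bool, Fintype.card_fin]
          exact Nat.mul_lt_mul_of_pos_right (add_one_pow_lt t ht) (by positivity)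
      _ = _ := by ring
  have h3 := (Nat.pow_lt_pow_iff_right (by norm_num : 1 < 2)).1 (Nat.lt_of_mul_lt_mul_left h2)
  omega

/-! ## The torus polynomial -/

theorem norm_coe_add_intCast_le (y : ℝ) (z : ℤ) : ‖((y + z : ℝ) : UnitAddCircle)‖ ≤ |y| := by
  rw [UnitAddCircle.norm_eq]
  simpa using round_le (y + z) z

theorem isTorusPoly_of_int {n D : ℕ} {G : (Fin n → Bool) → ℤ} (hG : G ∈ lowDegree ℤ n D) (N : ℝ) :
    IsTorusPoly D fun x => (((G x : ℝ) / N : ℝ) : UnitAddCircle) := by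
  obtain ⟨c, hc⟩ := exists_coeff_of_mem_lowDegree hG
  refine ⟨fun S => c S / N, fun x => ?_⟩
  beta_reduce
  congr 1
  rw [hc, Int.cast_sum, Finset.sum_div]
  refine Finset.sum_congr rfl fun S _ => ?_
  simp only [monom]
  push_cast
  ring

/-- Here `c` counts the 1-votes and `b` the wrong votes among ⌊N / 2⌋. Rounding N / 2 down costs at
most 1 / 2, which the step from n + 1 to n + 2 covers. -/
theorem abs_count_div_sub_half_le {N c b n : ℕ} (hN : 1 ≤ N) (β : Bool)
    (hb : b ≤ n + 1) (hc : if β then c + b = N / 2 else c = b) :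
    |(c : ℝ) / N - (if β then (1 : ℝ) else 0) / 2| ≤ (n + 2) / N := by
  have hN0 : (0 : ℝ) < N := by exact_mod_cast hN
  have hbR : (b : ℝ) ≤ n + 1 := by exact_mod_cast hb
  have hb0 : (0 : ℝ) ≤ b := Nat.cast_nonneg b
  cases β
  · simp only [Bool.false_eq_true, if_false] at hc ⊢
    rw [zero_div, sub_zero, abs_of_nonneg (by positivity), hc]
    gcongr
    linarith
  · simp only [if_true] at hc ⊢
    have h1 : 2 * (c + b) ≤ N := by omega
    have h2 : N ≤ 2 * (c + b) + 1 := by omega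
    have h1R : 2 * ((c : ℝ) + b) ≤ N := by exact_mod_cast h1
    have h2R : (N : ℝ) ≤ 2 * (c + b) + 1 := by exact_mod_cast h2
    have : (c : ℝ) / N - 1 / 2 = (c - N / 2) / N := by field_simp
    rw [this, abs_div, abs_of_pos hN0]
    gcongr
    rw [abs_le]
    constructor <;> linarith

/-- The condition `hs` makes the relative error s / 2 ^ k at most 1 / p ^ K, small enough for a
family of ⌊p ^ K / 2⌋ votes. -/
theorem toroidalDegree_le_of_hasCircuit {n p d s k K : ℕ} [Fact p.Prime] (hk : 1 ≤ k) (hK : K ≠ 0)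
    {f : BoolFun n} (hf : HasCircuit p d s f) (hs : s * p ^ K ≤ 2 ^ k) {ε : ℝ}
    (hε : (n + 2) / (p : ℝ) ^ K ≤ ε) :
    toroidalDegree ε f ≤ K * (K * ((p - 1) * (k * (p - 1)) ^ d)) := by
  classical
  have hp2 : 2 ≤ p := (Fact.out : p.Prime).two_le
  have hN2 : 2 ≤ p ^ K := hp2.trans (Nat.le_self_pow hK p)
  set D := (p - 1) * (k * (p - 1)) ^ d with hD
  obtain ⟨F, hFC, hFb⟩ := exists_family_few_errors (n := n) (t := p ^ K / 2) (by omega)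
    {F | F ∈ lowDegree (ZMod p) n D ∧ ∀ x, F x = 0 ∨ F x = 1} (fun x => bit (ZMod p) (f x)) (by
      intro w
      obtain ⟨F, hF, hF01, hFw⟩ := exists_approx_of_hasCircuit (p := p) hk hf w
      refine ⟨F, ⟨hF, hF01⟩, Nat.le_of_mul_le_mul_left (c := 2 ^ k) ?_ (by positivity)⟩
      calc _ = p ^ K / 2 * (2 ^ k * ∑ x with F x ≠ bit (ZMod p) (f x), w x) := by
            rw [mul_left_comm]
            congr!
        _ ≤ p ^ K / 2 * (s * ∑ x, w x) := Nat.mul_le_mul_left _ hFw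
        _ = (s * (p ^ K / 2)) * ∑ x, w x := by ring
        _ ≤ _ := Nat.mul_le_mul_right _
          ((Nat.mul_le_mul_left _ (Nat.div_le_self _ _)).trans hs))
  choose A hAD hA using fun i => exists_int_amplification K (hFC i).1 (hFC i).2
  refine Nat.sInf_le ⟨_, isTorusPoly_of_int (G := ∑ i, A i)
    (Submodule.sum_mem _ fun i _ => hAD i) ((p ^ K : ℕ) : ℝ), ?_⟩
  rw [Approximates, norm_le_iff]
  intro x
  -- After division by p ^ K, multiples of p ^ K vanish on the torus, so only the vote count
  -- remains.
  have hz : (p : ℤ) ^ K ∣ ∑ i, A i x - ∑ i, (if F i x = 1 then 1 else 0) := by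
    rw [← Finset.sum_sub_distrib]
    exact Finset.dvd_sum fun i _ => hA i x
  obtain ⟨z, hz⟩ := hz
  set c : ℕ := ∑ i, (if F i x = 1 then 1 else 0) with hc
  have hN0 : (((p ^ K : ℕ) : ℝ)) ≠ 0 := by positivity
  have hval : (((∑ i, A i) x : ℤ) : ℝ) / ((p ^ K : ℕ) : ℝ) = c / ((p ^ K : ℕ) : ℝ) + z := by
    have : (∑ i, A i) x = (c : ℤ) + (p : ℤ) ^ K * z := by
      rw [Finset.sum_apply, hc]
      push_cast
      linarith
    rw [this]
    push_cast at hN0 ⊢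
    field_simp
  rw [Pi.sub_apply, halfEmbed, hval, ← AddCircle.coe_sub, add_sub_right_comm]
  refine (norm_coe_add_intCast_le _ z).trans (le_trans ?_ hε)
  have hcount := abs_count_div_sub_half_le (N := p ^ K) (c := c) (by omega) (f x) (hFb x) (by
    by_cases hfx : f x = true
    · rw [if_pos hfx, hc, hfx, ← Finset.sum_add_distrib]
      calc _ = ∑ i : Fin (p ^ K / 2), 1 := Finset.sum_congr rfl fun i _ => by
            by_cases h1 : F i x = 1 <;> simp [h1, bit]
        _ = _ := by simp
    · rw [Bool.not_eq_true] at hfx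
      rw [hfx, if_neg (by simp), hc]
      refine Finset.sum_congr rfl fun i _ => ?_
      rcases (hFC i).2 x with h0 | h0 <;> simp [h0, bit])
  push_cast at hcount ⊢
  exact hcount

/-- The constant 1/4 is at distance 1/4 from both 0 and 1/2. This covers large ε, where log⁺(n / ε)
may vanish. -/
theorem toroidalDegree_eq_zero_of_quarter_le {n : ℕ} (f : BoolFun n) {ε : ℝ} (hε : 1 / 4 ≤ ε) :
    toroidalDegree ε f = 0 := by
  refine Nat.le_zero.1 (Nat.sInf_le ⟨_, isTorusPoly_of_int (one_mem_lowDegree 0) 4, ?_⟩)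
  rw [Approximates, norm_le_iff]
  intro x
  rw [Pi.sub_apply, halfEmbed, ← AddCircle.coe_sub]
  have h := norm_coe_add_intCast_le
    ((((1 : (Fin n → Bool) → ℤ) x : ℤ) : ℝ) / 4 - (if f x then (1 : ℝ) else 0) / 2) 0
  rw [Int.cast_zero, add_zero] at h
  refine h.trans (le_trans ?_ hε)
  rw [Pi.one_apply, Int.cast_one, abs_le]
  split_ifs <;> norm_num

/-- For n = 0 the final bound is 0, so degree 0 is required; f / 2 is itself constant. -/
theorem toroidalDegree_eq_zero_of_isEmpty (f : BoolFun 0) {ε : ℝ} (hε : 0 < ε) :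
    toroidalDegree ε f = 0 := by
  refine Nat.le_zero.1 (Nat.sInf_le ⟨_, isTorusPoly_of_int (Submodule.smul_mem _
    (if f Fin.elim0 then 1 else 0) (one_mem_lowDegree 0)) 2, ?_⟩)
  rw [Approximates, norm_le_iff]
  intro x
  rw [Pi.sub_apply, halfEmbed, Subsingleton.elim x Fin.elim0]
  simpa using hε.le

/-! ## The asymptotic bound -/

theorem eval_le_eval_one_mul_pow (q : Polynomial ℕ) {n : ℕ} (hn : 1 ≤ n) :
    q.eval n ≤ q.eval 1 * n ^ q.natDegree := by
  rw [Polynomial.eval_eq_sum_range, Polynomial.eval_eq_sum_range, Finset.sum_mul]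
  refine Finset.sum_le_sum fun i hi => ?_
  rw [one_pow, mul_one]
  exact Nat.mul_le_mul_left _ (Nat.pow_le_pow_right hn (by simpa [Nat.lt_succ_iff] using hi))

theorem toroidalDegree_le_log (p d : ℕ) [Fact p.Prime] (q : Polynomial ℕ) :
    ∃ (C : ℕ), ∀ (n : ℕ) (f : BoolFun n), 1 ≤ n → HasCircuit p d (q.eval n) f →
      ∀ (ε : ℝ) (M : ℕ), 1 ≤ M → 0 < ε → ε ≤ 1 → n / ε ≤ 2 ^ M →
        toroidalDegree ε f ≤ C * M ^ (d + 2) := by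
  have hp2 : 2 ≤ p := (Fact.out : p.Prime).two_le
  set a := q.eval 1
  set e := q.natDegree with he
  refine ⟨9 * (p - 1) * ((a + e + 3 * p) * (p - 1)) ^ d,
    fun n f hn hf ε M hM hε hε1 hnM => ?_⟩
  have hn1 : (1 : ℝ) ≤ n := by exact_mod_cast hn
  have hnε : (n : ℝ) ≤ 2 ^ M * ε := (div_le_iff₀ hε).1 hnM
  have hn2 : n ≤ 2 ^ M := by
    have : (n : ℝ) ≤ 2 ^ M := hnε.trans (mul_le_of_le_one_right (by positivity) hε1)
    exact_mod_cast this
  have hM2 : M + 2 ≤ 3 * M := by omega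
  have hk : 1 ≤ (a + e + 3 * p) * M := Nat.mul_pos (by omega) hM
  -- The 2 in `K` supplies a factor 4, absorbing n + 2 ≤ 3n. In `k`, the terms `a`, `e` and `3 * p`
  -- pay for q(1), n ^ e and p ^ (M + 2). The 9 in the constant comes from K ≤ 3M, squared.
  refine (toroidalDegree_le_of_hasCircuit (k := (a + e + 3 * p) * M) (K := M + 2) hk (by omega)
    hf ?_ ?_).trans ?_
  · calc q.eval n * p ^ (M + 2) ≤ (2 ^ (a * M) * 2 ^ (e * M)) * 2 ^ (3 * p * M) := by
          refine Nat.mul_le_mul ((eval_le_eval_one_mul_pow q hn).trans (Nat.mul_le_mul ?_ ?_)) ?_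
          · exact Nat.lt_two_pow_self.le.trans
              (Nat.pow_le_pow_right (by norm_num) (Nat.le_mul_of_pos_right _ hM))
          · rw [mul_comm, pow_mul]
            exact Nat.pow_le_pow_left hn2 _
          · calc p ^ (M + 2) ≤ (2 ^ p) ^ (M + 2) := Nat.pow_le_pow_left Nat.lt_two_pow_self.le _
              _ = 2 ^ (p * (M + 2)) := (pow_mul _ _ _).symm
              _ ≤ 2 ^ (3 * p * M) := Nat.pow_le_pow_right (by norm_num) (by
                rw [mul_comm 3 p, mul_assoc]
                exact Nat.mul_le_mul_left _ hM2)
      _ = 2 ^ ((a + e + 3 * p) * M) := by rw [← pow_add, ← pow_add, ← add_mul, ← add_mul]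
  · have h4 : (2 : ℝ) ^ (M + 2) ≤ (p : ℝ) ^ (M + 2) :=
      pow_le_pow_left₀ (by norm_num) (by exact_mod_cast hp2) _
    rw [div_le_iff₀ (by positivity)]
    calc (n : ℝ) + 2 ≤ 4 * (2 ^ M * ε) := by linarith
      _ = ε * 2 ^ (M + 2) := by ring
      _ ≤ _ := by gcongr
  · calc _ ≤ (3 * M) * ((3 * M) * ((p - 1) * ((a + e + 3 * p) * M * (p - 1)) ^ d)) := by gcongr
      _ = _ := by
        rw [mul_right_comm (a + e + 3 * p) M (p - 1), mul_pow _ M d]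
        ring

theorem exists_toroidalDegree_le_posLog (p : ℕ) (hp : p.Prime) (d : ℕ) (q : Polynomial ℕ) :
    ∃ (C : ℝ) (c : ℕ), ∀ (n : ℕ) (f : BoolFun n), HasCircuit p d (q.eval n) f →
      ∀ ε : ℝ, 0 < ε → (toroidalDegree ε f : ℝ) ≤ C * Real.posLog (n / ε) ^ c := by
  have : Fact p.Prime := ⟨hp⟩
  obtain ⟨C, hC⟩ := toroidalDegree_le_log p d q
  refine ⟨C * 3 ^ (d + 2), d + 2, fun n f hf ε hε => ?_⟩
  have hpos : 0 ≤ (C : ℝ) * 3 ^ (d + 2) * Real.posLog (n / ε) ^ (d + 2) :=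
    mul_nonneg (by positivity) (pow_nonneg Real.posLog_nonneg _)
  rcases Nat.eq_zero_or_pos n with rfl | hn
  · rw [toroidalDegree_eq_zero_of_isEmpty f hε]
    exact_mod_cast hpos
  by_cases hε4 : 1 / 4 ≤ ε
  · rw [toroidalDegree_eq_zero_of_quarter_le f hε4, Nat.cast_zero]
    exact hpos
  push Not at hε4
  have hn1 : (1 : ℝ) ≤ n := by exact_mod_cast hn
  have h4 : 4 ≤ n / ε := by
    rw [le_div_iff₀ hε]
    linarith
  have hlog2 := Real.log_two_gt_d9
  have hlog4 : Real.log 4 = 2 * Real.log 2 := by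
    rw [show (4 : ℝ) = 2 ^ 2 by norm_num, Real.log_pow]
    norm_num
  have hlog : Real.log 4 ≤ Real.log (n / ε) := Real.log_le_log (by norm_num) h4
  have hL : Real.posLog (n / ε) = Real.log (n / ε) := max_eq_right (by linarith)
  rw [hL]
  set L := Real.log (n / ε)
  have hL0 : 0 < L := by linarith
  -- M = ⌈2L⌉ works because 2 log 2 > 1 gives 2 ^ (2L) ≥ exp L = n / ε, while L ≥ log 4 > 1 gives M
  -- ≤ 3L.
  have hM1 : 1 ≤ ⌈2 * L⌉₊ := Nat.ceil_pos.2 (by linarith)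
  have hM3 : (⌈2 * L⌉₊ : ℝ) ≤ 3 * L := by
    have := (Nat.ceil_lt_add_one (by linarith : 0 ≤ 2 * L)).le
    linarith
  have hle : n / ε ≤ 2 ^ ⌈2 * L⌉₊ := by
    rw [← Real.log_le_log_iff (by linarith) (by positivity), Real.log_pow]
    have := Nat.le_ceil (2 * L)
    nlinarith
  calc (toroidalDegree ε f : ℝ) ≤ C * (⌈2 * L⌉₊ : ℝ) ^ (d + 2) := by
        exact_mod_cast hC n f hn hf ε _ hM1 hε (by linarith) hle
    _ ≤ C * (3 * L) ^ (d + 2) := by gcongr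
    _ = _ := by ring

end TorusApprox

theorem mainTheorem5 (p : ℕ) (hp : p.Prime) :
    (∀ f ∈ TorusApprox.AC0 p, ∃ (C : ℝ) (c : ℕ), ∀ (n : ℕ) (ε : ℝ), 0 < ε →
      (TorusApprox.toroidalDegree ε (f n) : ℝ) ≤ C * Real.posLog (n / ε) ^ c) ∧
    (∀ (d : ℕ) (q : Polynomial ℕ), ∃ (C : ℝ) (c : ℕ),
      ∀ (n : ℕ) (f : TorusApprox.BoolFun n), TorusApprox.HasCircuit p d (q.eval n) f →
        ∀ ε : ℝ, 0 < ε →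
          (TorusApprox.toroidalDegree ε f : ℝ) ≤ C * Real.posLog (n / ε) ^ c) := by
  have h := TorusApprox.exists_toroidalDegree_le_posLog p hp
  refine ⟨fun f ⟨d, q, hf⟩ => ?_, h⟩
  obtain ⟨C, c, hC⟩ := h d q
  exact ⟨C, c, fun n ε hε => hC n (f n) (hf n) ε hε⟩
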